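/- Let $M$, $L$, $L_1$, $L_2$ be integers with $M\ge 1$ and $1\le L_2<L_1\le L$, and put $N=2^L$. For $1\le L_c\le L$ and ranks $r_0,\dots,r_{L_c-1}$, the truncated hierarchical decomposition with $L_c$ levels has as parameters vectors $\mathbf a^{0,j,\gamma}\in\mathbb R^M$ ($1\le j\le N$, $1\le\gamma\le r_0$), $\mathbf a^{l,j,\gamma}\in\mathbb R^{r_{l-1}}$ ($1\le l\le L_c-1$, $1\le j\le N/2^l$, $1\le\gamma\le r_l$) and $\mathbf a^{L_c}\in\mathbb R^{r_{L_c-1}}$. With $\phi^{0,j,\gamma}:=\mathbf a^{0,j,\gamma}$ it generates tensors $$\phi^{l,j,\gamma}=\sum_{\alpha=1}^{r_{l-1}}a^{l,j,\gamma}_\alpha\,\phi^{l-1,2j-1,\alpha}\otimes\phi^{l-1,2j,\alpha}\quad(1\le l\le L_c-1),\qquad \mathcal A=\sum_{\alpha=1}^{r_{L_c-1}}a^{L_c}_\alpha\bigotimes_{j=1}^{2^{L-L_c+1}}\phi^{L_c-1,j,\alpha},$$ where $\mathcal A$ has order $N$ and dimension $M$ in each mode. In the shared version the vectors $\mathbf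 a^{l,j,\gamma}=\mathbf a^{l,\gamma}$ with $0\le l\le L_c-1$ do not depend on $j$, and the parameters are the $\mathbf a^{l,\gamma}$ and $\mathbf a^{L_c}$. Fix positive ranks $r^{(1)}_0,\dots,r^{(1)}_{L_1-1}$ and let $r=\min\{r^{(1)}_0,\dots,r^{(1)}_{L_2-1},M\}$. Then for all parameter configurations of the $L_1$-level decomposition with ranks $r^{(1)}_l$, outside a set of Lebesgue measure zero in the space of these configurations, the generated tensor $\mathcal A^{(1)}$ has the following property: whenever a tensor $\mathcal A^{(2)}$ generated by an $L_2$-level decomposition (for the same $M$ and $N$), with any ranks $r^{(2)}_0,\dots,r^{(2)}_{L_2-1}$ and any (unshared) parameters, equals $\mathcal A^{(1)}$, one has $$r^{(2)}_{L_2-1}\ \ge\ r^{\,2^{L-L_2}}.$$ The same holds if the $L_1$-level decomposition is constrained to be shared and the exceptional set is taken in the space of shared configurations with its Lebesgue measure. -/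

import Mathlib

namespace HTDecomp

/-- Real tensors of order `N` and dimension `M` in each mode, as arrays of entries. -/
abbrev Tensor (M N : ℕ) : Type := (Fin N → Fin M) → ℝ

/-- The tensor product `T 0 ⊗ T 1 ⊗ ⋯ ⊗ T (m - 1)` of `m` tensors of the same order `n`, a tensor
of order `N = m * n`.  The modes of factor `j` are the modes `j * n + i` with `i < n` of the
product. -/
def tensorProd {M m n N : ℕ} (h : m * n = N) (T : Fin m → Tensor M n) : Tensor M N :=
  fun d => ∏ j : Fin m, T j (fun i => d (Fin.cast h (finProdFinEquiv (j, i))))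

/-- Indices of the individual real parameters of the truncated hierarchical decomposition with `Lc`
levels and ranks `r 0, …, r (Lc - 1)`, of tensors of order `2 ^ L` and dimension `M` in each mode:
* `(j, γ, i)`: entry `i` of the vector `a^{0,j,γ} ∈ ℝ ^ M`;
* `⟨l, j, γ, α⟩`: entry `α` of the vector `a^{l+1,j,γ} ∈ ℝ ^ (r l)`, where `1 ≤ l + 1 ≤ Lc - 1`;
* `α`: entry `α` of the final vector `a^{Lc} ∈ ℝ ^ (r (Lc - 1))`.
Locations `j` and channels `γ` are counted from `0`. -/
abbrev ParamIdx (M L Lc : ℕ) (r : ℕ → ℕ) : Type :=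
  (Fin (2 ^ L) × Fin (r 0) × Fin M) ⊕
  (Σ l : Fin (Lc - 1), Fin (2 ^ (L - (l + 1))) × Fin (r (l + 1)) × Fin (r l)) ⊕
  Fin (r (Lc - 1))

/-- The Euclidean space of parameter configurations; `volume` on it is Lebesgue measure. -/
abbrev Params (M L Lc : ℕ) (r : ℕ → ℕ) : Type := ParamIdx M L Lc r → ℝ

/-- Parameter indices in the shared setting, where the vectors of levels `0, …, Lc - 1` do not
depend on the location `j`. -/
abbrev SharedParamIdx (M Lc : ℕ) (r : ℕ → ℕ) : Type :=
  (Fin (r 0) × Fin M) ⊕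
  (Σ l : Fin (Lc - 1), Fin (r (l + 1)) × Fin (r l)) ⊕
  Fin (r (Lc - 1))

/-- The Euclidean space of shared parameter configurations; `volume` on it is Lebesgue measure. -/
abbrev SharedParams (M Lc : ℕ) (r : ℕ → ℕ) : Type := SharedParamIdx M Lc r → ℝ

/-- The configuration `a^{l,j,γ} := a^{l,γ}` given by a shared configuration. -/
def SharedParams.toParams {M Lc : ℕ} (L : ℕ) {r : ℕ → ℕ} (a : SharedParams M Lc r) :
    Params M L Lc r
  | .inl (_, γ, i) => a (.inl (γ, i))
  | .inr (.inl ⟨l, _, γ, α⟩) => a (.inr (.inl ⟨l, γ, α⟩))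
  | .inr (.inr α) => a (.inr (.inr α))

theorem two_pow_mul_two {L l : ℕ} (h : l + 1 ≤ L) : 2 ^ (L - (l + 1)) * 2 = 2 ^ (L - l) := by
  rw [← pow_succ]
  congr 1
  omega

theorem two_pow_mul_two_pow {L l : ℕ} (h : l ≤ L) : 2 ^ (L - l) * 2 ^ l = 2 ^ L := by
  rw [← pow_add]
  congr 1
  omega

/-- The location `2 * j + b` at level `l`, for a location `j` at level `l + 1` and `b < 2`. -/
def child {L l : ℕ} (h : l + 1 ≤ L) (j : Fin (2 ^ (L - (l + 1)))) (b : Fin 2) :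
    Fin (2 ^ (L - l)) :=
  Fin.cast (two_pow_mul_two h) (finProdFinEquiv (j, b))

/-- The tensors `φ^{l,j,γ}` of order `2 ^ l`, for `l ≤ Lc - 1`.  At level `0` they are the vectors
`a^{0,j,γ}`, and `φ^{l+1,j,γ} = ∑ α, a^{l+1,j,γ}_α • (φ^{l,2j,α} ⊗ φ^{l,2j+1,α})`. -/
noncomputable def phi {M L Lc : ℕ} {r : ℕ → ℕ} (hL : Lc ≤ L) (a : Params M L Lc r) :
    (l : ℕ) → l ≤ Lc - 1 → Fin (2 ^ (L - l)) → Fin (r l) → Tensor M (2 ^ l)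
  | 0, _, j, γ => fun d => a (.inl (j, γ, d 0))
  | l + 1, hl, j, γ =>
      ∑ α : Fin (r l), a (.inr (.inl ⟨⟨l, hl⟩, j, γ, α⟩)) •
        tensorProd (pow_succ' 2 l).symm
          (fun b : Fin 2 => phi hL a l (by omega) (child (by omega) j b) α)

/-- The tensor of order `2 ^ L` generated by the truncated decomposition with `Lc` levels:
`∑ α, a^{Lc}_α • ⨂ j, φ^{Lc-1,j,α}`, over all `2 ^ (L - Lc + 1)` locations `j`. -/
noncomputable def generated {M L Lc : ℕ} {r : ℕ → ℕ} (hL : Lc ≤ L) (a : Params M L Lc r) :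
    Tensor M (2 ^ L) :=
  ∑ α : Fin (r (Lc - 1)), a (.inr (.inr α)) •
    tensorProd (two_pow_mul_two_pow (by omega : Lc - 1 ≤ L))
      (fun j => phi hL a (Lc - 1) le_rfl j α)

/-- `min {r 0, …, r (K - 1), M}`. -/
def minRank (M K : ℕ) (r : ℕ → ℕ) : ℕ :=
  (insert M ((Finset.range K).image r)).min' (Finset.insert_nonempty _ _)

end HTDecomp

/-!
Put `L₂ = H + 1`, and cut the `2 ^ L` modes into consecutive blocks of `2 ^ H` modes.  Arrange a
tensor as a matrix whose rows are indexed by the modes in even-numbered blocks and whose columns are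
indexed by the modes in odd-numbered blocks.  Each of the `r₂ H` summands of a tensor generated by an
`L₂`-level decomposition is a product over these blocks, so it becomes a matrix of rank at most one
and the whole matrix has rank at most `r₂ H`.  It is enough to bound the rank of one submatrix: with
`s = minRank M L₂ r₁`, rows and columns are restricted to multi-indices that are constant on each
block with values below `s` (`interleave`).  A nonzero determinant of this square submatrix of size
`s ^ 2 ^ (L - L₂)` gives the bound (`le_rank_of_interleavedMinor_ne_zero`).

For an `L₁`-level decomposition the determinant is a polynomial, hence analytic, function of the
parameters, and it is not identically zero: there are parameters, even shared ones, for which the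
submatrix is the identity (`diagonalParams`, `interleavedMinor_diagonalParams`).  They make
`φ^{l,γ} = e_γ ⊗ ⋯ ⊗ e_γ` for `l ≤ H`, then `φ^{H+1,γ} = ∑_{α < s} e_α ⊗ ⋯ ⊗ e_α`, and the later
levels just take tensor products of these; this is where `L₂ < L₁` is needed.  An analytic function
that is nonzero somewhere is nonzero almost everywhere (`ae_ne_zero_of_analytic`), in the space of
all configurations and in the space of shared ones alike.
-/

/-! ### Zero sets of analytic functions -/

open MeasureTheory in
/-- The zero set of a real analytic function on `E` that does not vanish at `w` is a null set.  On
each line through `w` the zeros form a discrete set; by Fubini, some dilation of the zero set about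
`w` is then null, and so is the zero set itself. -/
theorem ae_ne_zero_of_analytic {E : Type*} [NormedAddCommGroup E] [NormedSpace ℝ E]
    [FiniteDimensional ℝ E] [MeasurableSpace E] [BorelSpace E] (μ : Measure E)
    [μ.IsAddHaarMeasure] {f : E → ℝ} (hf : ∀ x, AnalyticAt ℝ f x) {w : E} (hw : f w ≠ 0) :
    ∀ᵐ x ∂μ, f x ≠ 0 := by
  have hfc : Continuous f := continuous_iff_continuousAt.2 fun x => (hf x).continuousAt
  -- On a line through `w` the function is nonzero at `t = 0`, so its zeros there are isolated.
  have hline : ∀ x : E, ∀ᵐ t : ℝ, f (w + t • x) ≠ 0 := by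
    intro x
    have hg : AnalyticOnNhd ℝ (fun t : ℝ => f (w + t • x)) Set.univ := by
      intro t _
      exact (hf (w + t • x)).fun_comp (f := fun t : ℝ => w + t • x) (by fun_prop)
    have hcod := hg.preimage_zero_mem_codiscrete (x := 0) (by simpa using hw)
    have := ae_restrict_le_codiscreteWithin (μ := (volume : Measure ℝ)) MeasurableSet.univ hcod
    rw [Measure.restrict_univ] at this
    filter_upwards [this] with t ht using ht
  have hmeas : MeasurableSet {z : E × ℝ | f (w + z.2 • z.1) ≠ 0} :=
    (isOpen_ne.preimage (by fun_prop : Continuous fun z : E × ℝ =>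
      f (w + z.2 • z.1))).measurableSet
  have hswap : ∀ᵐ t : ℝ, ∀ᵐ x ∂μ, f (w + t • x) ≠ 0 :=
    (Measure.ae_ae_comm (p := fun x t => f (w + t • x) ≠ 0) hmeas).1 (.of_forall hline)
  obtain ⟨t, ht, ht0⟩ := (hswap.and (volume.ae_ne (0 : ℝ))).exists
  -- The set in `ht` is the zero set translated by `-w` and scaled by `t⁻¹`.
  have hnull : μ ((fun x => t • x) ⁻¹' ((fun x => w + x) ⁻¹' {x | f x = 0})) = 0 := by
    simpa [ae_iff] using ht
  rw [Measure.addHaar_preimage_smul μ ht0, measure_preimage_add, mul_eq_zero] at hnull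
  have hscale : ENNReal.ofReal |(t ^ Module.finrank ℝ E)⁻¹| ≠ 0 := by
    simp [ht0]
  simpa [ae_iff] using hnull.resolve_left hscale

namespace HTDecomp

/-! ### Analytic dependence on the parameters -/

theorem analyticAt_coord {ι : Type*} [Fintype ι] (i : ι) (x : ι → ℝ) :
    AnalyticAt ℝ (fun a : ι → ℝ => a i) x :=
  (ContinuousLinearMap.proj (R := ℝ) (φ := fun _ : ι => ℝ) i).analyticAt x

theorem analyticAt_phi {M L Lc : ℕ} {r : ℕ → ℕ} (hL : Lc ≤ L) (l : ℕ) (hl : l ≤ Lc - 1)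
    (j : Fin (2 ^ (L - l))) (γ : Fin (r l)) (d : Fin (2 ^ l) → Fin M) (x : Params M L Lc r) :
    AnalyticAt ℝ (fun a : Params M L Lc r => phi hL a l hl j γ d) x := by
  induction l with
  | zero => simp only [phi]; exact analyticAt_coord _ x
  | succ l ih =>
    simp only [phi, Finset.sum_apply, Pi.smul_apply, smul_eq_mul, tensorProd]
    refine Finset.analyticAt_fun_sum _ fun α _ => AnalyticAt.mul (analyticAt_coord _ x) ?_
    exact Finset.analyticAt_fun_prod _ fun b _ => ih _ _ _ _

theorem analyticAt_generated {M L Lc : ℕ} {r : ℕ → ℕ} (hL : Lc ≤ L)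
    (d : Fin (2 ^ L) → Fin M) (x : Params M L Lc r) :
    AnalyticAt ℝ (fun a : Params M L Lc r => generated hL a d) x := by
  simp only [generated, Finset.sum_apply, Pi.smul_apply, smul_eq_mul, tensorProd]
  refine Finset.analyticAt_fun_sum _ fun α _ => AnalyticAt.mul (analyticAt_coord _ x) ?_
  exact Finset.analyticAt_fun_prod _ fun b _ => analyticAt_phi _ _ _ _ _ _ _

theorem analyticAt_toParams {M L Lc : ℕ} {r : ℕ → ℕ} (x : SharedParams M Lc r) :
    AnalyticAt ℝ (fun a : SharedParams M Lc r => a.toParams L) x := by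
  rw [analyticAt_pi_iff]
  rintro (⟨_, γ, i⟩ | ⟨l, _, γ, α⟩ | α) <;> exact analyticAt_coord _ x

/-! ### Blocks of modes -/

theorem val_block {m n N : ℕ} (h : m * n = N) (j : Fin m) (i : Fin n) :
    (Fin.cast h (finProdFinEquiv (j, i))).val = i + n * j := rfl

theorem forall_block_iff {m n N : ℕ} (h : m * n = N) {P : Fin N → Prop} :
    (∀ (j : Fin m) (i : Fin n), P (Fin.cast h (finProdFinEquiv (j, i)))) ↔ ∀ p, P p := by
  rw [← ((finProdFinEquiv).trans (finCongr h)).forall_congr_right, Prod.forall]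
  rfl

/-- The multi-index `d` is constant on each block of `K` consecutive modes
`k * K, …, k * K + K - 1`. -/
def BlockConst {M N : ℕ} (K : ℕ) (d : Fin N → Fin M) : Prop :=
  ∀ p q : Fin N, p.val / K = q.val / K → d p = d q

/-- If `K` divides `n`, no block of length `K` straddles two of the `m` groups of `n` modes. -/
theorem blockConst_iff {M m n N K : ℕ} (h : m * n = N) (hK : K ∣ n) (d : Fin N → Fin M) :
    BlockConst K d ↔
      ∀ j : Fin m, BlockConst K fun i => d (Fin.cast h (finProdFinEquiv (j, i))) := by
  obtain ⟨c, rfl⟩ := hK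
  constructor
  · intro hd j p q hpq
    refine hd _ _ ?_
    have hK : 0 < K := by
      by_contra hK
      obtain rfl : K = 0 := by omega
      exact absurd p.2 (by simp)
    simp only [val_block, mul_assoc, Nat.add_mul_div_left _ _ hK, hpq]
  · intro hd p
    revert p
    rw [← forall_block_iff h]
    intro j i q
    revert q
    rw [← forall_block_iff h]
    intro j' i' hq
    have hj : ∀ (j : Fin m) (i : Fin (K * c)), (i + K * c * j : ℕ) / K / c = j := fun j i => by
      rw [Nat.div_div_eq_div_mul, Nat.add_mul_div_left _ _ (Nat.zero_lt_of_lt i.2),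
        Nat.div_eq_of_lt i.2, zero_add]
    simp only [val_block] at hq
    obtain rfl : j = j' := Fin.ext (by rw [← hj j i, ← hj j' i', hq])
    refine hd j i i' ?_
    have hK : 0 < K := by
      by_contra hK
      obtain rfl : K = 0 := by omega
      exact absurd i.2 (by simp)
    simpa only [mul_assoc, Nat.add_mul_div_left _ _ hK, Nat.add_right_cancel_iff] using hq

/-! ### Bounds on `minRank` -/

theorem minRank_le_dim (M K : ℕ) (r : ℕ → ℕ) : minRank M K r ≤ M :=
  Finset.min'_le _ _ (by simp)

theorem minRank_le_rank (M : ℕ) {K l : ℕ} (r : ℕ → ℕ) (hl : l < K) : minRank M K r ≤ r l :=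
  Finset.min'_le _ _ (Finset.mem_insert_of_mem (Finset.mem_image_of_mem _ (by simpa using hl)))

/-! ### Parameters generating a block-diagonal tensor -/

theorem prod_indicator {ι : Type*} [Fintype ι] (P : ι → Prop) [DecidablePred P]
    [Decidable (∀ i, P i)] :
    (∏ i, if P i then (1 : ℝ) else 0) = if ∀ i, P i then 1 else 0 := by
  simp [Finset.prod_ite_zero]

/-- Shared parameters whose tensor has entry `1` at multi-indices with values below `s` that are
constant on blocks of length `2 ^ (H + 1)`, and `0` at the other multi-indices with values below `s`:
`a^{0,γ} = e_γ`; `a^{l,γ} = e_γ` for `1 ≤ l ≤ H`; `a^{H+1,γ} = ∑_{α < s} e_α` for all `γ`; and all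
later vectors are `e_0`.  Since `l : Fin (Lc - 1)` stands for level `l + 1`, the case distinction
compares `l` with `H`.  A vector `e_γ` with `γ` out of range is zero. -/
def diagonalParams (M Lc H s : ℕ) (r : ℕ → ℕ) : SharedParams M Lc r
  | .inl (γ, i) => if γ.val = i.val then 1 else 0
  | .inr (.inl ⟨l, γ, α⟩) =>
      if l.val < H then if γ.val = α.val then 1 else 0
      else if l.val = H then if α.val < s then 1 else 0
      else if α.val = 0 then 1 else 0
  | .inr (.inr α) => if α.val = 0 then 1 else 0

theorem sum_indicator_mul {n k : ℕ} (hk : k < n) (F : Fin n → ℝ) :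
    ∑ α : Fin n, (if k = α.val then (1 : ℝ) else 0) * F α = F ⟨k, hk⟩ := by
  rw [Finset.sum_eq_single (⟨k, hk⟩ : Fin n)]
  · simp
  · intro α _ hα
    rw [if_neg (fun h => hα (Fin.ext h.symm)), zero_mul]
  · simp

section Witness
variable {M L Lc H s : ℕ} {r : ℕ → ℕ}

/-- Up to level `H`, the tensors are the powers `e_γ ⊗ ⋯ ⊗ e_γ`. -/
theorem phi_diagonalParams_of_le (hL : Lc ≤ L) (hs : ∀ l ≤ H, s ≤ r l) {l : ℕ} (hl : l ≤ Lc - 1)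
    (hlH : l ≤ H) (j : Fin (2 ^ (L - l))) (γ : Fin (r l)) (hγ : γ.val < s)
    (d : Fin (2 ^ l) → Fin M) :
    phi hL ((diagonalParams M Lc H s r).toParams L) l hl j γ d =
      if ∀ p, (d p).val = γ.val then 1 else 0 := by
  induction l with
  | zero =>
    have : (∀ p : Fin (2 ^ 0), (d p).val = γ.val) ↔ γ.val = (d 0).val :=
      ⟨fun h => (h 0).symm, fun h p => by rw [h, show p = 0 from Fin.ext (by have := p.2; simp_all)]⟩
    simp only [phi, SharedParams.toParams, diagonalParams, this]
  | succ l ih =>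
    have hlt : γ.val < r l := hγ.trans_le (hs l (by omega))
    have hlH' : l < H := hlH
    simp only [phi, Finset.sum_apply, Pi.smul_apply, smul_eq_mul, SharedParams.toParams,
      diagonalParams, hlH', if_true]
    rw [sum_indicator_mul hlt]
    simp only [tensorProd]
    rw [Finset.prod_congr rfl fun b _ => ih _ (by omega) _ ⟨γ, hlt⟩ hγ _, prod_indicator]
    simp only [forall_block_iff _ (P := fun p => (d p).val = γ.val)]

open Classical in
/-- From level `H + 1` on, restricted to indices below `s`, the tensors are the products of copies of
`∑_{α < s} e_α ⊗ ⋯ ⊗ e_α` over the blocks of length `2 ^ (H + 1)`. -/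
theorem phi_diagonalParams_of_gt (hL : Lc ≤ L) (hr : ∀ l < Lc, 0 < r l)
    (hs : ∀ l ≤ H, s ≤ r l) {l : ℕ} (hl : l ≤ Lc - 1)
    (hlH : H + 1 ≤ l) (j : Fin (2 ^ (L - l))) (γ : Fin (r l))
    (d : Fin (2 ^ l) → Fin M) (hd : ∀ p, (d p).val < s) :
    phi hL ((diagonalParams M Lc H s r).toParams L) l hl j γ d =
      if BlockConst (2 ^ (H + 1)) d then 1 else 0 := by
  induction l, hlH using Nat.le_induction with
  | base =>
    simp only [phi, Finset.sum_apply, Pi.smul_apply, smul_eq_mul, SharedParams.toParams,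
      diagonalParams, lt_irrefl, if_true, if_false]
    -- Only the channel `α = d 0` can contribute, and it does so when `d` is constant.
    have hterm : ∀ α : Fin (r H), (if α.val < s then (1 : ℝ) else 0) *
        tensorProd (pow_succ' 2 H).symm (fun b : Fin 2 =>
          phi hL ((diagonalParams M Lc H s r).toParams L) H (by omega)
            (child (by omega) j b) α) d =
        (if (d ⟨0, by positivity⟩).val = α.val then 1 else 0) *
          (if BlockConst (2 ^ (H + 1)) d then 1 else 0) := by
      intro α
      have hconst : (∀ p, (d p).val = α.val) ↔
          (d ⟨0, by positivity⟩).val = α.val ∧ BlockConst (2 ^ (H + 1)) d := by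
        constructor
        · exact fun h => ⟨h _, fun p q _ => Fin.ext ((h p).trans (h q).symm)⟩
        · rintro ⟨h0, h⟩ p
          rw [← h0, h p ⟨0, by positivity⟩ (by simp [Nat.div_eq_of_lt p.2])]
      by_cases hα : α.val < s
      · simp only [tensorProd]
        rw [Finset.prod_congr rfl fun b _ =>
          phi_diagonalParams_of_le hL hs _ le_rfl _ α hα _, prod_indicator]
        simp only [forall_block_iff _ (P := fun p => (d p).val = α.val), hconst, hα, if_true,
          one_mul, ite_and]
        split_ifs <;> simp
      · have : (d ⟨0, by positivity⟩).val ≠ α.val := fun h => hα (h ▸ hd _)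
        rw [if_neg hα, if_neg this, zero_mul, zero_mul]
    rw [Finset.sum_congr rfl fun α _ => hterm α,
      sum_indicator_mul ((hd _).trans_le (hs H le_rfl)) (fun _ => _)]
  | succ l hle ih =>
    have h1 : ¬ l < H := by omega
    have h2 : l ≠ H := by omega
    -- `eq_comm` brings the weights `if α = 0` into the form that `sum_indicator_mul` expects.
    simp only [phi, Finset.sum_apply, Pi.smul_apply, smul_eq_mul, SharedParams.toParams,
      diagonalParams, h1, h2, if_false, eq_comm (b := 0)]
    rw [sum_indicator_mul (hr l (by omega))]
    simp only [tensorProd]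
    rw [Finset.prod_congr rfl fun b _ => ih _ _ _ _ fun _ => hd _, prod_indicator]
    simp only [← blockConst_iff _ (pow_dvd_pow 2 hle)]

open Classical in
theorem generated_diagonalParams (hL : Lc ≤ L) (hr : ∀ l < Lc, 0 < r l)
    (hs : ∀ l ≤ H, s ≤ r l) (hH : H + 1 < Lc)
    (d : Fin (2 ^ L) → Fin M) (hd : ∀ p, (d p).val < s) :
    generated hL ((diagonalParams M Lc H s r).toParams L) d =
      if BlockConst (2 ^ (H + 1)) d then 1 else 0 := by
  have hle : H + 1 ≤ Lc - 1 := by omega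
  simp only [generated, Finset.sum_apply, Pi.smul_apply, smul_eq_mul, SharedParams.toParams,
      diagonalParams, eq_comm (b := 0)]
  rw [sum_indicator_mul (hr (Lc - 1) (by omega))]
  simp only [tensorProd]
  rw [Finset.prod_congr rfl fun b _ => phi_diagonalParams_of_gt hL hr hs _ hle _ _ _ fun _ => hd _,
    prod_indicator]
  simp only [← blockConst_iff _ (pow_dvd_pow 2 hle)]

end Witness

/-! ### The even-odd minor -/

/-- The multi-index that is constant on each block of `2 ^ H` modes, with value `f k` on the
even-numbered block `2 * k` and `g k` on the odd-numbered block `2 * k + 1`. -/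
def interleave {M L H s : ℕ} (hH : H + 1 ≤ L) (hs : s ≤ M)
    (f g : Fin (2 ^ (L - (H + 1))) → Fin s) (p : Fin (2 ^ L)) : Fin M :=
  Fin.castLE hs ((if p.val / 2 ^ H % 2 = 0 then f else g)
    ⟨p.val / 2 ^ (H + 1), Nat.div_lt_of_lt_mul (by
      rw [mul_comm, two_pow_mul_two_pow hH]; exact p.2)⟩)

theorem interleave_apply {M L H s : ℕ} (hH : H + 1 ≤ L) (hs : s ≤ M)
    (f g : Fin (2 ^ (L - (H + 1))) → Fin s) (p : Fin (2 ^ L)) {k : ℕ} (hk : p.val / 2 ^ H = k)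
    (hk' : k / 2 < 2 ^ (L - (H + 1))) :
    interleave hH hs f g p = Fin.castLE hs ((if k % 2 = 0 then f else g) ⟨k / 2, hk'⟩) := by
  subst hk
  have : p.val / 2 ^ (H + 1) = p.val / 2 ^ H / 2 := by rw [pow_succ, Nat.div_div_eq_div_mul]
  simp only [interleave, this]

theorem blockConst_interleave_iff {M L H s : ℕ} (hH : H + 1 ≤ L) (hs : s ≤ M)
    (f g : Fin (2 ^ (L - (H + 1))) → Fin s) :
    BlockConst (2 ^ (H + 1)) (interleave hH hs f g) ↔ f = g := by
  constructor
  · intro h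
    funext j
    -- Compare the first modes of the blocks `2 * j` and `2 * j + 1`.
    have hpos : 0 < 2 ^ H := by positivity
    have hN : 2 ^ (L - (H + 1)) * 2 ^ (H + 1) = 2 ^ L := two_pow_mul_two_pow hH
    have hj : (j.val + 1) * 2 ^ (H + 1) ≤ 2 ^ L := hN ▸ Nat.mul_le_mul_right _ j.2
    have hpow : 2 ^ (H + 1) = 2 * 2 ^ H := pow_succ' 2 H
    have e1 : 2 ^ H * (2 * j.val) / 2 ^ H = 2 * j.val := Nat.mul_div_cancel_left _ hpos
    have e2 : 2 ^ H * (2 * j.val + 1) / 2 ^ H = 2 * j.val + 1 := Nat.mul_div_cancel_left _ hpos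
    have e3 : 2 ^ H * (2 * j.val) / 2 ^ (H + 1) = j.val := by
      rw [pow_succ, ← Nat.div_div_eq_div_mul, e1]; omega
    have e4 : 2 ^ H * (2 * j.val + 1) / 2 ^ (H + 1) = j.val := by
      rw [pow_succ, ← Nat.div_div_eq_div_mul, e2]; omega
    have := h ⟨2 ^ H * (2 * j.val), by nlinarith⟩ ⟨2 ^ H * (2 * j.val + 1), by nlinarith⟩
      (e3.trans e4.symm)
    simpa [interleave, e1, e2, e3, e4, Nat.add_mod] using this
  · rintro rfl p q hpq
    simp only [interleave, ite_self, hpq]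

/-- The submatrix of a tensor generated with `H + 1` levels factors through the `r H` channels of
level `H`, since each factor `φ^{H,j,α}` sees only the row index or only the column index. -/
theorem generated_interleave {M L H s : ℕ} (hH : H + 1 ≤ L) (hs : s ≤ M) {r : ℕ → ℕ}
    (b : Params M L (H + 1) r) :
    ∃ (U : Matrix (Fin (2 ^ (L - (H + 1))) → Fin s) (Fin (r H)) ℝ)
      (V : Matrix (Fin (r H)) (Fin (2 ^ (L - (H + 1))) → Fin s) ℝ),
      (Matrix.of fun f g => generated hH b (interleave hH hs f g)) = U * V := by
  have hlt : ∀ j : Fin (2 ^ (L - H)), j.val / 2 < 2 ^ (L - (H + 1)) := fun j =>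
    Nat.div_lt_of_lt_mul (by rw [mul_comm, two_pow_mul_two hH]; exact j.2)
  refine ⟨.of fun f α => b (.inr (.inr α)) * ∏ j : Fin (2 ^ (L - H)),
      if j.val % 2 = 0 then phi hH b H le_rfl j α fun _ => Fin.castLE hs (f ⟨j / 2, hlt j⟩) else 1,
    .of fun α g => ∏ j : Fin (2 ^ (L - H)),
      if j.val % 2 = 0 then 1 else phi hH b H le_rfl j α fun _ => Fin.castLE hs (g ⟨j / 2, hlt j⟩),
    ?_⟩
  ext f g
  simp only [Matrix.of_apply, Matrix.mul_apply, generated, Finset.sum_apply, Pi.smul_apply,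
    smul_eq_mul]
  refine Finset.sum_congr rfl fun α _ => ?_
  rw [mul_assoc, ← Finset.prod_mul_distrib]
  congr 1
  simp only [tensorProd]
  refine Finset.prod_congr rfl fun j _ => ?_
  have e1 : ∀ i : Fin (2 ^ H), (i + 2 ^ H * j.val : ℕ) / 2 ^ H = j := fun i => by
    rw [Nat.add_mul_div_left _ _ (by positivity), Nat.div_eq_of_lt i.2, zero_add]
  have hblock : (fun i : Fin (2 ^ H) => interleave hH hs f g
      (Fin.cast (two_pow_mul_two_pow (by omega)) (finProdFinEquiv (j, i)))) =
      fun _ => Fin.castLE hs ((if j.val % 2 = 0 then f else g) ⟨j / 2, hlt j⟩) :=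
    funext fun i => interleave_apply hH hs f g _ (e1 i) (hlt j)
  refine (congrArg (phi hH b H le_rfl j α) hblock).trans ?_
  split_ifs <;> simp

/-- The minor of the matricization of `A` by even against odd blocks of `2 ^ H` modes, with rows and
columns given by multi-indices that are constant on blocks and have values below `s`. -/
noncomputable def interleavedMinor {M L H : ℕ} (hH : H + 1 ≤ L) {s : ℕ} (hs : s ≤ M)
    (A : Tensor M (2 ^ L)) : ℝ :=
  (Matrix.of fun f g : Fin (2 ^ (L - (H + 1))) → Fin s => A (interleave hH hs f g)).det

theorem le_rank_of_interleavedMinor_ne_zero {M L H s : ℕ} (hH : H + 1 ≤ L) (hs : s ≤ M)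
    {r : ℕ → ℕ} (b : Params M L (H + 1) r)
    (h : interleavedMinor hH hs (generated hH b) ≠ 0) :
    s ^ 2 ^ (L - (H + 1)) ≤ r H := by
  obtain ⟨U, V, hUV⟩ := generated_interleave hH hs b
  have hrank := Matrix.rank_of_isUnit _ ((Matrix.isUnit_iff_isUnit_det _).2 (isUnit_iff_ne_zero.2 h))
  rw [hUV] at hrank
  have := (Matrix.rank_mul_le_left U V).trans (Matrix.rank_le_card_width U)
  rw [hrank] at this
  simpa using this

theorem interleavedMinor_diagonalParams {M L Lc H s : ℕ} {r : ℕ → ℕ} (hL : Lc ≤ L)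
    (hH : H + 1 < Lc) (hs : s ≤ M) (hr : ∀ l < Lc, 0 < r l) (hsr : ∀ l ≤ H, s ≤ r l) :
    interleavedMinor (hH.le.trans hL) hs
      (generated hL ((diagonalParams M Lc H s r).toParams L)) = 1 := by
  classical
  rw [interleavedMinor]
  convert Matrix.det_one (n := Fin (2 ^ (L - (H + 1))) → Fin s) (R := ℝ)
  ext f g
  have hlt : ∀ p, (interleave (hH.le.trans hL) hs f g p).val < s := fun p =>
    Fin.is_lt (n := s) _
  rw [Matrix.of_apply, generated_diagonalParams hL hr hsr hH _ hlt, Matrix.one_apply]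
  simp only [blockConst_interleave_iff]

theorem analyticAt_interleavedMinor {M L Lc H s : ℕ} {r : ℕ → ℕ} (hL : Lc ≤ L)
    (hH : H + 1 ≤ L) (hs : s ≤ M) (x : Params M L Lc r) :
    AnalyticAt ℝ (fun a : Params M L Lc r => interleavedMinor hH hs (generated hL a)) x := by
  simp only [interleavedMinor, Matrix.det_apply, Matrix.of_apply]
  refine Finset.analyticAt_fun_sum _ fun σ _ => ?_
  have : AnalyticAt ℝ (fun a : Params M L Lc r => ∏ f,
      generated hL a (interleave hH hs (σ f) f)) x :=
    Finset.analyticAt_fun_prod _ fun f _ => analyticAt_generated hL _ x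
  rcases Int.units_eq_one_or (Equiv.Perm.sign σ) with h | h
  · simpa [h] using this
  · simpa [h] using this.fun_neg

end HTDecomp

open MeasureTheory in
theorem theorem2 (M L L₁ L₂ : ℕ) (hL₂ : 1 ≤ L₂) (hL₂₁ : L₂ < L₁) (hL₁ : L₁ ≤ L)
    (r₁ : ℕ → ℕ) (hr₁ : ∀ l < L₁, 0 < r₁ l) :
    (∀ᵐ a : HTDecomp.Params M L L₁ r₁ ∂volume,
      ∀ (r₂ : ℕ → ℕ) (b : HTDecomp.Params M L L₂ r₂),
        HTDecomp.generated (hL₂₁.le.trans hL₁) b = HTDecomp.generated hL₁ a →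
          HTDecomp.minRank M L₂ r₁ ^ 2 ^ (L - L₂) ≤ r₂ (L₂ - 1)) ∧
    (∀ᵐ a : HTDecomp.SharedParams M L₁ r₁ ∂volume,
      ∀ (r₂ : ℕ → ℕ) (b : HTDecomp.Params M L L₂ r₂),
        HTDecomp.generated (hL₂₁.le.trans hL₁) b = HTDecomp.generated hL₁ (a.toParams L) →
          HTDecomp.minRank M L₂ r₁ ^ 2 ^ (L - L₂) ≤ r₂ (L₂ - 1)) := by
  obtain ⟨H, rfl⟩ : ∃ H, L₂ = H + 1 := ⟨L₂ - 1, by omega⟩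
  have hH : H + 1 ≤ L := hL₂₁.le.trans hL₁
  have hs := HTDecomp.minRank_le_dim M (H + 1) r₁
  have hw : HTDecomp.interleavedMinor hH hs (HTDecomp.generated hL₁
      ((HTDecomp.diagonalParams M L₁ H (HTDecomp.minRank M (H + 1) r₁) r₁).toParams L)) ≠ 0 := by
    rw [HTDecomp.interleavedMinor_diagonalParams hL₁ hL₂₁ hs hr₁
      fun l hl => HTDecomp.minRank_le_rank M r₁ (by omega)]
    exact one_ne_zero
  constructor
  · filter_upwards [ae_ne_zero_of_analytic volume
      (HTDecomp.analyticAt_interleavedMinor hL₁ hH hs) hw] with a ha r₂ b hb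
    exact HTDecomp.le_rank_of_interleavedMinor_ne_zero hH hs b (by rwa [hb])
  · filter_upwards [ae_ne_zero_of_analytic volume
      (fun x => (HTDecomp.analyticAt_interleavedMinor hL₁ hH hs _).fun_comp
        (HTDecomp.analyticAt_toParams x)) hw] with a ha r₂ b hb
    exact HTDecomp.le_rank_of_interleavedMinor_ne_zero hH hs b (by rwa [hb])
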